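/- Let $d,p\ge 1$ be integers, $\mathbb S^d$ the unit sphere of $\mathbb R^{d+1}$ and $\vartheta(x,y)=\arccos(x^\top y)$ its geodesic distance. Let $G_n^{\lambda}$ denote the Gegenbauer polynomials, given by $G_0^\lambda(r)=1$, $G_1^\lambda(r)=2\lambda r$ and $G_n^\lambda(r)=\frac{2(n+\lambda-1)}{n}\,r\,G_{n-1}^\lambda(r)-\frac{n+2\lambda-2}{n}\,G_{n-2}^\lambda(r)$ for $n\ge2$; for $d=1$ (that is, $\lambda=(d-1)/2=0$) use instead the convention $G_n^{0}(\cos\theta)=\cos(n\theta)$. Let $(B_{n,d})_{n\ge 0}$ be real positive semidefinite $p\times p$ matrices such that $\sum_{n\ge0} B_{n,d}\,G_n^{(d-1)/2}(1)$ converges entrywise, let $\Gamma_{n,d}$ be real $p\times p$ matrices with $B_{n,d}=\Gamma_{n,d}\Gamma_{n,d}^\top$, let $\gamma^{(i)}_{n,d}$ be the $i$-th column of $\Gamma_{n,d}$, and put $$K(\theta)=\sum_{n=0}^\infty B_{n,d}\,G_n^{(d-1)/2}(\cos\theta),\qquad 0\le\theta\le\pi .$$ Let $\varepsilon$ be a real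 random variable with zero mean and unit variance, $\omega$ a random vector uniformly distributed on $\mathbb S^d$, $\iota$ uniformly distributed on $\{1,\dots,p\}$, and $\kappa$ a random nonnegative integer with $\mathbb P(\kappa=n)=a_n$, where $a_n\neq0$ whenever $B_{n,d}\ne0$. Suppose that $\varepsilon,\omega,\iota,\kappa$ are mutually independent. Call a $p$-variate random field on $\mathbb S^d$ with finite second-order moments isotropic with isotropic part $M$ if it has constant mean and the covariance matrix of its values at $x$ and $y$ equals $M(\vartheta(x,y))$ for all $x,y\in\mathbb S^d$, where $M$ is continuous on $[0,\pi]$. Then the series defining $K$ converges entrywise on $[0,\pi]$, and the following hold. (1) Let $d=1$. (a) The random field $Z(x)=\varepsilon\sqrt{\frac{2p}{a_\kappa}}\;\gamma^{(\iota)}_{\kappa,1}\cos(\kappa\,\vartheta(\omega,x))$, $x\in\mathbb S^1$, is isotropic with zero mean and isotropic part $B_{0,1}+K$; so its isotropic part is $K$ when $B_{0,1}=0$. (b) The random field $Z(x)=\varepsilon\sqrt{\frac{c_\kappa\,p}{a_\kappa}}\;\gamma^{(\iota)}_{\kappa,1}\cos(\kappa\,\vartheta(\omega,x))$, $x\in\mathbb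 S^1$, where $c_0=1$ and $c_n=2$ for $n\ge1$, is isotropic with zero mean and isotropic part $K(\theta)=\sum_{n\ge0}B_{n,1}\cos(n\theta)$. (2) If $d\ge2$, the random field $Z(x)=\varepsilon\sqrt{\frac{p\,(2\kappa+d-1)}{a_\kappa\,(d-1)}}\;\gamma^{(\iota)}_{\kappa,d}\,G_\kappa^{(d-1)/2}(\omega^\top x)$, $x\in\mathbb S^d$, is isotropic with zero mean and isotropic part $K$. -/

import Mathlib

open MeasureTheory ProbabilityTheory

noncomputable section

namespace TurningArcs

/-- The `d`-dimensional unit sphere in `ℝ^(d+1)` with its Euclidean structure. -/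
abbrev Sph (d : ℕ) : Type := Metric.sphere (0 : EuclideanSpace ℝ (Fin (d + 1))) 1

/-- The uniform probability measure on the sphere: normalized surface measure. -/
def uniformSphere (d : ℕ) : Measure (Sph d) :=
  ((volume : Measure (EuclideanSpace ℝ (Fin (d + 1)))).toSphere Set.univ)⁻¹ •
    (volume : Measure (EuclideanSpace ℝ (Fin (d + 1)))).toSphere

/-- The dot product `xᵀ y` of two points of the sphere. -/
def dot {d : ℕ} (x y : Sph d) : ℝ :=
  inner ℝ (x : EuclideanSpace ℝ (Fin (d + 1))) (y : EuclideanSpace ℝ (Fin (d + 1)))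

/-- The geodesic distance `ϑ(x, y) = arccos (xᵀ y)`. -/
def geodesic {d : ℕ} (x y : Sph d) : ℝ := Real.arccos (dot x y)

/-- The Gegenbauer polynomials `G_n^l`, by their three-term recurrence. -/
def gegenbauer (l : ℝ) : ℕ → ℝ → ℝ
  | 0, _ => 1
  | 1, r => 2 * l * r
  | n + 2, r =>
      2 * ((n + 2 : ℝ) + l - 1) / (n + 2 : ℝ) * r * gegenbauer l (n + 1) r
        - ((n + 2 : ℝ) + 2 * l - 2) / (n + 2 : ℝ) * gegenbauer l n r

/-- `G_n^((d-1)/2) (cos θ)`, with the convention `G_n^0 (cos θ) = cos (n θ)` when `d = 1`. -/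
def schoenbergBasis (d n : ℕ) (θ : ℝ) : ℝ :=
  if d = 1 then Real.cos (n * θ) else gegenbauer (((d : ℝ) - 1) / 2) n (Real.cos θ)

/-- Sequences of Schoenberg matrices: positive semidefinite matrices `B_n` such that
`∑ B_n G_n^((d-1)/2) (1)` converges entrywise. -/
structure IsSchoenbergSequence (d : ℕ) {p : ℕ} (B : ℕ → Matrix (Fin p) (Fin p) ℝ) : Prop where
  posSemidef : ∀ n, (B n).PosSemidef
  summable : ∀ i j, Summable fun n => B n i j * schoenbergBasis d n 0

/-- The Schoenberg expansion `K(θ) = ∑ B_n G_n^((d-1)/2) (cos θ)`, entrywise. -/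
def schoenbergSeries (d : ℕ) {p : ℕ} (B : ℕ → Matrix (Fin p) (Fin p) ℝ) (θ : ℝ) :
    Matrix (Fin p) (Fin p) ℝ :=
  Matrix.of fun i j => ∑' n, B n i j * schoenbergBasis d n θ

/-- The `p`-variate random field `Z` has finite second-order moments and is (weakly) isotropic:
its mean is constant and its matrix covariance function is `K (ϑ(x, y))`, where the isotropic
part `K` is continuous on `[0, π]`. -/
structure IsIsotropicWith {Ω : Type*} [MeasurableSpace Ω] (μ : Measure Ω) {d p : ℕ}
    (Z : Sph d → Ω → Fin p → ℝ) (K : ℝ → Matrix (Fin p) (Fin p) ℝ) : Prop where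
  memLp : ∀ x i, MemLp (fun w => Z x w i) 2 μ
  mean_const : ∃ m : Fin p → ℝ, ∀ x i, ∫ w, Z x w i ∂μ = m i
  continuousOn : ContinuousOn K (Set.Icc 0 Real.pi)
  cov_eq : ∀ x y i j,
    covariance (fun w => Z x w i) (fun w => Z y w j) μ = K (geodesic x y) i j

/-- `Z(x) = ε √(c_κ p / a_κ) γ_κ^(ι) cos (κ ϑ(ω, x))`, the field used on the circle, where
`γ_n^(i)` is the `i`-th column of `Γ_n`. -/
def cosineField {Ω : Type*} {d p : ℕ} (c a : ℕ → ℝ) (Γ : ℕ → Matrix (Fin p) (Fin p) ℝ)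
    (ε : Ω → ℝ) (ω : Ω → Sph d) (ι : Ω → Fin p) (κ : Ω → ℕ)
    (x : Sph d) (w : Ω) : Fin p → ℝ :=
  (ε w * √(c (κ w) * p / a (κ w)) * Real.cos (κ w * geodesic (ω w) x)) • (Γ (κ w)).col (ι w)

/-- `Z(x) = ε √(p (2κ + d - 1) / (a_κ (d - 1))) γ_κ^(ι) G_κ^((d-1)/2) (ωᵀ x)`, where
`γ_n^(i)` is the `i`-th column of `Γ_n`. -/
def gegenbauerField {Ω : Type*} {d p : ℕ} (a : ℕ → ℝ) (Γ : ℕ → Matrix (Fin p) (Fin p) ℝ)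
    (ε : Ω → ℝ) (ω : Ω → Sph d) (ι : Ω → Fin p) (κ : Ω → ℕ)
    (x : Sph d) (w : Ω) : Fin p → ℝ :=
  (ε w * √(p * (2 * (κ w : ℝ) + (d : ℝ) - 1) / (a (κ w) * ((d : ℝ) - 1)))
    * gegenbauer (((d : ℝ) - 1) / 2) (κ w) (dot (ω w) x)) • (Γ (κ w)).col (ι w)

end TurningArcs

end

open TurningArcs

/-! Since `ε` is centred, of unit variance and independent of the rest, the field has mean zero and
its covariance is the expected product of the amplitudes without `ε`. On `κ = n`, averaging over `ι`
turns the columns of `Γ n` into `B n / p`, the squared root cancels `p` and the probability `a n`,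
and a spherical average of two zonal functions of degree `n` remains. With `l = (d - 1) / 2` and
`Z_n = (n + l) / l * G_n^l`, everything rests on the reproducing identity `E[Z_n(ω · x) Z_n(ω · y)]
= Z_n(x · y)` (`integral_zonal_mul_zonal`). The `Z_n` make sense at `l = 0`, so the circle needs no
separate argument.

The identity is proved without harmonic analysis. Gaussian integration by parts in polar coordinates
gives a recurrence for sphere moments (`toSphere_moment_recurrence`), which amounts to the
divergence theorem for the pairing of two zonal polynomials. Hence the Gegenbauer operator is
symmetric and distinct degrees are orthogonal; its Dirichlet form reduces the pairing of `Z_(n+1)`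
with itself to pairings of `G_n^(l+1)` and `G_(n-1)^(l+1)`, and induction on the degree closes
(`zonalPairing_zonal_self_aux`).

The same identity bounds `Z_n` on `[-1, 1]` by its value at `1`, so the diagonal series at angle `0`
dominates the whole expansion: this yields convergence and continuity. -/

namespace TurningArcs

open Polynomial

/-! ### Gegenbauer and zonal polynomials. -/

/-- The Gegenbauer polynomials `G_{n-1}^(l+1)`, shifted so that the sequence starts with `0`. -/
noncomputable def derivGegenbauer (l : ℝ) : ℕ → ℝ[X]
  | 0 => 0
  | 1 => 1
  | n + 2 => C (2 * ((n : ℝ) + 1 + l) / (n + 1)) * X * derivGegenbauer l (n + 1)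
      - C (((n : ℝ) + 1 + 2 * l) / (n + 1)) * derivGegenbauer l n

/-- The zonal polynomials `(n + l) / l * G_n^l`, extended by continuity to `l = 0`. -/
noncomputable def zonal (l : ℝ) : ℕ → ℝ[X]
  | 0 => 1
  | n + 1 => derivGegenbauer l (n + 2) - derivGegenbauer l n

variable {l : ℝ}

lemma eval_derivGegenbauer_add_two (n : ℕ) (t : ℝ) :
    ((n : ℝ) + 1) * (derivGegenbauer l (n + 2)).eval t =
      2 * ((n : ℝ) + 1 + l) * t * (derivGegenbauer l (n + 1)).eval t
        - ((n : ℝ) + 1 + 2 * l) * (derivGegenbauer l n).eval t := by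
  have : (n : ℝ) + 1 ≠ 0 := by positivity
  simp only [derivGegenbauer, eval_sub, eval_mul, eval_C, eval_X]
  field_simp

lemma eval_derivative_derivGegenbauer_add_two (n : ℕ) (t : ℝ) :
    ((n : ℝ) + 1) * (derivative (derivGegenbauer l (n + 2))).eval t =
      2 * ((n : ℝ) + 1 + l) * ((derivGegenbauer l (n + 1)).eval t
          + t * (derivative (derivGegenbauer l (n + 1))).eval t)
        - ((n : ℝ) + 1 + 2 * l) * (derivative (derivGegenbauer l n)).eval t := by
  have : (n : ℝ) + 1 ≠ 0 := by positivity
  simp only [derivGegenbauer, derivative_sub, derivative_mul, derivative_C, derivative_X, eval_sub,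
    eval_add, eval_mul, eval_C, eval_X, eval_zero, eval_one]
  field_simp
  ring

lemma eval_zonal_succ (n : ℕ) (t : ℝ) :
    ((n : ℝ) + 1) * (zonal l (n + 1)).eval t =
      2 * ((n : ℝ) + 1 + l) *
        (t * (derivGegenbauer l (n + 1)).eval t - (derivGegenbauer l n).eval t) := by
  simp only [zonal, eval_sub]
  linear_combination eval_derivGegenbauer_add_two (l := l) n t

/-- Neither relation propagates alone. Together they give `key`, a derivative formula across two
degrees, from which both follow at the next degree. -/
lemma derivative_derivGegenbauer_relations (n : ℕ) (t : ℝ) :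
    t * (derivative (derivGegenbauer l (n + 1))).eval t
        - (derivative (derivGegenbauer l n)).eval t = n * (derivGegenbauer l (n + 1)).eval t ∧
    (derivative (derivGegenbauer l (n + 1))).eval t
        - t * (derivative (derivGegenbauer l n)).eval t
      = ((n : ℝ) + 1 + 2 * l) * (derivGegenbauer l n).eval t := by
  induction n with
  | zero => simp [derivGegenbauer]
  | succ n ih =>
    obtain ⟨h1, h2⟩ := ih
    have hn : (n : ℝ) + 1 ≠ 0 := by positivity
    have hV := eval_derivGegenbauer_add_two (l := l) n t
    have hD := eval_derivative_derivGegenbauer_add_two (l := l) n t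
    have key : (derivative (derivGegenbauer l (n + 2))).eval t
        - (derivative (derivGegenbauer l n)).eval t
        = 2 * ((n : ℝ) + 1 + l) * (derivGegenbauer l (n + 1)).eval t := by
      apply mul_left_cancel₀ hn
      linear_combination hD + 2 * ((n : ℝ) + 1 + l) * h1
    push_cast
    constructor
    · linear_combination t * key - h2 - hV
    · linear_combination key - h1

lemma derivative_zonal (n : ℕ) :
    derivative (zonal l n) = C (2 * ((n : ℝ) + l)) * derivGegenbauer l n := by
  cases n with
  | zero => simp [zonal, derivGegenbauer]
  | succ n =>
    refine Polynomial.funext fun t => ?_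
    have h1 := (derivative_derivGegenbauer_relations (l := l) n t).1
    have h2 := (derivative_derivGegenbauer_relations (l := l) (n + 1) t).2
    simp only [zonal, derivative_sub, eval_sub, eval_mul, eval_C]
    push_cast at *
    linear_combination h2 + h1

/-- The Gegenbauer operator `(1 - t²) f'' - (2 l + 1) t f'`. -/
noncomputable def gegenbauerOp (l : ℝ) (f : ℝ[X]) : ℝ[X] :=
  (1 - X ^ 2) * derivative (derivative f) - C (2 * l + 1) * X * derivative f

lemma gegenbauerOp_zonal (n : ℕ) :
    gegenbauerOp l (zonal l n) = C (-((n : ℝ) * (n + 2 * l))) * zonal l n := by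
  cases n with
  | zero => simp [gegenbauerOp, zonal]
  | succ n =>
    refine Polynomial.funext fun t => ?_
    obtain ⟨h1, h2⟩ := derivative_derivGegenbauer_relations (l := l) n t
    have h3 := eval_zonal_succ (l := l) n t
    simp only [gegenbauerOp, derivative_zonal, derivative_mul, derivative_C, eval_sub, eval_mul,
      eval_C, eval_X, eval_one, eval_pow, eval_add, eval_zero]
    push_cast at *
    linear_combination (-2 * ((n : ℝ) + 1 + l) * t) * h1 + (2 * ((n : ℝ) + 1 + l)) * h2
      + (n + 1 + 2 * l) * h3

/-- This reflects `(1 - 2tr + r²)^(-l) = (1 - 2tr + r²) (1 - 2tr + r²)^(-(l+1))` for generating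
functions, read off at `r ^ (n + 1)`; the proof only uses the recurrences. -/
lemma gegenbauer_eq_derivGegenbauer (n : ℕ) (t : ℝ) :
    gegenbauer l (n + 1) t = (derivGegenbauer l (n + 2)).eval t
      - 2 * t * (derivGegenbauer l (n + 1)).eval t + (derivGegenbauer l n).eval t := by
  induction n using Nat.twoStepInduction with
  | zero => simp [gegenbauer, derivGegenbauer]; ring
  | one => simp [gegenbauer, derivGegenbauer]; ring
  | more n ih1 ih2 =>
    have hn : ((n : ℝ) + 3) ≠ 0 := by positivity
    have e1 := eval_derivGegenbauer_add_two (l := l) n t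
    have e2 := eval_derivGegenbauer_add_two (l := l) (n + 1) t
    have e3 := eval_derivGegenbauer_add_two (l := l) (n + 2) t
    have hg : ((n : ℝ) + 3) * gegenbauer l (n + 3) t =
        2 * ((n : ℝ) + 2 + l) * t * gegenbauer l (n + 2) t
          - ((n : ℝ) + 1 + 2 * l) * gegenbauer l (n + 1) t := by
      simp only [gegenbauer]
      push_cast
      field_simp
      ring
    apply mul_left_cancel₀ hn
    rw [hg, ih1, ih2]
    push_cast at *
    linear_combination 2 * t * e2 - e1 - e3

lemma mul_gegenbauer_eq_zonal (n : ℕ) (t : ℝ) :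
    ((n : ℝ) + l) * gegenbauer l n t = l * (zonal l n).eval t := by
  cases n with
  | zero => simp [gegenbauer, zonal]
  | succ n =>
    have h := eval_derivGegenbauer_add_two (l := l) n t
    rw [gegenbauer_eq_derivGegenbauer]
    simp only [zonal, eval_sub]
    push_cast
    linear_combination h

/-- At `l = 0` the shifted sequence consists of Chebyshev polynomials of the second kind, and
differences two steps apart are `2 T_(n+1)`. -/
lemma eval_zonal_zero_cos (n : ℕ) (θ : ℝ) :
    (zonal 0 (n + 1)).eval (Real.cos θ) = 2 * Real.cos ((n + 1 : ℕ) * θ) := by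
  have hrec (n : ℕ) (t : ℝ) : (derivGegenbauer 0 (n + 2)).eval t =
      2 * t * (derivGegenbauer 0 (n + 1)).eval t - (derivGegenbauer 0 n).eval t := by
    have hn : (n : ℝ) + 1 ≠ 0 := by positivity
    apply mul_left_cancel₀ hn
    linear_combination eval_derivGegenbauer_add_two (l := 0) n t
  induction n using Nat.twoStepInduction with
  | zero => simp [zonal, derivGegenbauer]
  | one =>
    simp [zonal, derivGegenbauer, one_add_one_eq_two, Real.cos_two_mul]
    ring
  | more n ih1 ih2 =>
    have hc : Real.cos ((n + 2 + 1 : ℕ) * θ) =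
        2 * Real.cos θ * Real.cos ((n + 1 + 1 : ℕ) * θ) - Real.cos ((n + 1 : ℕ) * θ) := by
      have e1 : ((n + 2 + 1 : ℕ) : ℝ) * θ = (n + 1 + 1 : ℕ) * θ + θ := by push_cast; ring
      have e2 : ((n + 1 : ℕ) : ℝ) * θ = (n + 1 + 1 : ℕ) * θ - θ := by push_cast; ring
      rw [e1, e2, Real.cos_add, Real.cos_sub]
      ring
    rw [hc]
    simp only [zonal, eval_sub] at *
    have r1 := hrec (n + 2) (Real.cos θ)
    have r2 := hrec n (Real.cos θ)
    linear_combination r1 - r2 + 2 * Real.cos θ * ih2 - ih1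

/-! ### Sphere moments from Gaussian integrals. -/

section Polar

open Set Metric

variable {E : Type*} [NormedAddCommGroup E] [InnerProductSpace ℝ E] [FiniteDimensional ℝ E]
  [Nontrivial E] [MeasurableSpace E] [BorelSpace E] (μ : Measure E) [μ.IsAddHaarMeasure]

/-- Polar coordinates: homogeneity separates the radius from the direction, so identities for
Gaussian moments transfer to the sphere. -/
lemma integral_homogeneous_mul_exp (f : E → ℝ) (k : ℕ)
    (hf : ∀ r : ℝ, 0 < r → ∀ z, f (r • z) = r ^ k * f z) :
    ∫ z, f z * Real.exp (-‖z‖ ^ 2) ∂μ = (∫ u : sphere (0 : E) 1, f u ∂μ.toSphere) *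
      ∫ r in Ioi (0 : ℝ), r ^ (Module.finrank ℝ E - 1 + k) * Real.exp (-r ^ 2) := by
  calc
    _ = ∫ z : ({(0)}ᶜ : Set E), f z * Real.exp (-‖(z : E)‖ ^ 2) ∂(μ.comap (↑)) := by
      rw [integral_subtype_comap (measurableSet_singleton _).compl
        fun z ↦ f z * Real.exp (-‖z‖ ^ 2), restrict_compl_singleton]
    _ = ∫ q : sphere (0 : E) 1 × Ioi (0 : ℝ), f q.1 * ((q.2 : ℝ) ^ k * Real.exp (-(q.2 : ℝ) ^ 2))
          ∂μ.toSphere.prod (.volumeIoiPow (Module.finrank ℝ E - 1)) := by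
      rw [← μ.measurePreserving_homeomorphUnitSphereProd.integral_comp
        (Homeomorph.measurableEmbedding _)]
      refine integral_congr_ae (.of_forall fun z => ?_)
      have hz : 0 < ‖(z : E)‖ := norm_pos_iff.2 z.2
      have h := hf ‖(z : E)‖ hz (‖(z : E)‖⁻¹ • (z : E))
      rw [smul_inv_smul₀ hz.ne'] at h
      simp only [homeomorphUnitSphereProd_apply_fst_coe, homeomorphUnitSphereProd_apply_snd_coe]
      rw [h]
      ring
    _ = _ := by
      rw [integral_prod_mul (fun u : sphere (0 : E) 1 => f u)
        (fun r : Ioi (0 : ℝ) => (r : ℝ) ^ k * Real.exp (-(r : ℝ) ^ 2))]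
      congr 1
      simp only [Measure.volumeIoiPow, ENNReal.ofReal]
      rw [integral_withDensity_eq_integral_smul (by fun_prop),
        integral_subtype_comap measurableSet_Ioi fun a ↦
          Real.toNNReal (a ^ (Module.finrank ℝ E - 1)) • (a ^ k * Real.exp (-a ^ 2)),
        setIntegral_congr_fun measurableSet_Ioi fun x hx ↦ ?_]
      rw [NNReal.smul_def, Real.coe_toNNReal _ (pow_nonneg hx.out.le _), smul_eq_mul, pow_add]
      ring

lemma integral_pow_mul_exp_neg_sq (m : ℕ) :
    ∫ r in Ioi (0 : ℝ), r ^ m * Real.exp (-r ^ 2) = Real.Gamma (((m : ℝ) + 1) / 2) / 2 := by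
  have h := integral_rpow_mul_exp_neg_rpow (p := 2) (q := m) two_pos
    (by linarith [(Nat.cast_nonneg m : (0 : ℝ) ≤ m)])
  simp only [Real.rpow_natCast, Real.rpow_two] at h
  rw [h]
  ring

lemma integrable_pow_norm_mul_exp (k : ℕ) :
    Integrable (fun z : E => ‖z‖ ^ k * Real.exp (-‖z‖ ^ 2)) μ := by
  rw [integrable_fun_norm_addHaar μ (f := fun r => r ^ k * Real.exp (-r ^ 2))]
  have h := integrableOn_rpow_mul_exp_neg_rpow (p := 2) (s := (Module.finrank ℝ E - 1 + k : ℕ))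
    (by linarith [(Nat.cast_nonneg _ : (0 : ℝ) ≤ (Module.finrank ℝ E - 1 + k : ℕ))]) two_pos
  simp only [Real.rpow_natCast, Real.rpow_two, pow_add] at h
  simpa only [smul_eq_mul, mul_assoc] using h

lemma integrable_inner_pow_mul_exp (x y : E) (i j : ℕ) :
    Integrable (fun z : E => inner ℝ z x ^ i * inner ℝ z y ^ j * Real.exp (-‖z‖ ^ 2)) μ := by
  refine ((integrable_pow_norm_mul_exp μ (i + j)).const_mul (‖x‖ ^ i * ‖y‖ ^ j)).mono'
    (by fun_prop) (.of_forall fun z => ?_)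
  rw [norm_mul, norm_mul, norm_pow, norm_pow, Real.norm_of_nonneg (Real.exp_pos _).le]
  calc _ ≤ (‖z‖ * ‖x‖) ^ i * (‖z‖ * ‖y‖) ^ j * Real.exp (-‖z‖ ^ 2) := by
        gcongr <;> exact norm_inner_le_norm _ _
    _ = _ := by ring

/-- Gaussian integration by parts for the monomials `(z · x) ^ i (z · y) ^ j`. -/
lemma integral_inner_pow_by_parts (x y : E) (hx : inner ℝ x x = (1 : ℝ)) (i j : ℕ) :
    2 * ∫ z, inner ℝ z x ^ (i + 1) * inner ℝ z y ^ j * Real.exp (-‖z‖ ^ 2) ∂μ =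
      i * ∫ z, inner ℝ z x ^ (i - 1) * inner ℝ z y ^ j * Real.exp (-‖z‖ ^ 2) ∂μ +
      j * inner ℝ x y * ∫ z, inner ℝ z x ^ i * inner ℝ z y ^ (j - 1) * Real.exp (-‖z‖ ^ 2) ∂μ := by
  have hderiv (z : E) : HasLineDerivAt ℝ
      (fun z : E => inner ℝ z x ^ i * inner ℝ z y ^ j * Real.exp (-‖z‖ ^ 2))
      (i * (inner ℝ z x ^ (i - 1) * inner ℝ z y ^ j * Real.exp (-‖z‖ ^ 2)) +
        j * inner ℝ x y * (inner ℝ z x ^ i * inner ℝ z y ^ (j - 1) * Real.exp (-‖z‖ ^ 2)) -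
        2 * (inner ℝ z x ^ (i + 1) * inner ℝ z y ^ j * Real.exp (-‖z‖ ^ 2))) z x := by
    have h1 (v : E) : HasDerivAt (fun t : ℝ => inner ℝ (z + t • x) v) (inner ℝ x v) 0 := by
      have h := ((hasDerivAt_id (0 : ℝ)).mul_const (inner ℝ x v)).const_add (inner ℝ z v)
      rw [one_mul] at h
      refine h.congr_of_eventuallyEq (.of_forall fun t => ?_)
      simp [inner_add_left, inner_smul_left]
    have h2 : HasDerivAt (fun t : ℝ => ‖z + t • x‖ ^ 2) (2 * inner ℝ z x) 0 := by
      have h3 : HasDerivAt (fun t : ℝ => z + t • x) x 0 := by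
        simpa using ((hasDerivAt_id (0 : ℝ)).smul_const x).const_add z
      simpa using h3.norm_sq
    have h := (((h1 x).pow i).mul ((h1 y).pow j)).mul h2.neg.exp
    refine HasDerivAt.congr_deriv h ?_
    simp only [Pi.mul_apply, Pi.pow_apply, Pi.neg_apply, zero_smul, add_zero, hx]
    ring
  have hI := integrable_inner_pow_mul_exp μ x y
  have h1 := ((hI (i - 1) j).const_mul (i : ℝ))
  have h2 := ((hI i (j - 1)).const_mul (j * inner ℝ x y : ℝ))
  have h3 := ((hI (i + 1) j).const_mul (2 : ℝ))
  -- With the constant `1` as the other factor, integration by parts says that the directional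
  -- derivative integrates to zero.
  have h := integral_bilinear_hasLineDerivAt_right_eq_neg_left_of_integrable (μ := μ)
    (f := fun _ : E => (1 : ℝ)) (f' := fun _ => 0) (v := x) (B := ContinuousLinearMap.mul ℝ ℝ)
    (by simp) (by simpa using! (h1.add h2).sub h3) (by simpa using hI i j)
    (fun z _ => hasDerivAt_const _ _) (fun z _ => hderiv z)
  simp only [ContinuousLinearMap.mul_apply', one_mul, zero_mul, integral_zero, neg_zero] at h
  rw [integral_sub (by simpa using! h1.add h2) h3, integral_add h1 h2] at h
  simp only [integral_const_mul] at h
  linarith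

lemma toSphere_moment_recurrence (x y : E) (hx : inner ℝ x x = (1 : ℝ)) (i j : ℕ) :
    ((Module.finrank ℝ E : ℝ) - 1 + i + j) *
        ∫ u : sphere (0 : E) 1, inner ℝ (u : E) x ^ (i + 1) * inner ℝ (u : E) y ^ j ∂μ.toSphere =
      i * ∫ u : sphere (0 : E) 1, inner ℝ (u : E) x ^ (i - 1) * inner ℝ (u : E) y ^ j ∂μ.toSphere +
      j * inner ℝ x y *
        ∫ u : sphere (0 : E) 1, inner ℝ (u : E) x ^ i * inner ℝ (u : E) y ^ (j - 1)
          ∂μ.toSphere := by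
  have hn : ((Module.finrank ℝ E - 1 : ℕ) : ℝ) = (Module.finrank ℝ E : ℝ) - 1 := by
    rw [Nat.cast_sub Module.finrank_pos, Nat.cast_one]
  have hhom (i j : ℕ) : ∫ z, inner ℝ z x ^ i * inner ℝ z y ^ j * Real.exp (-‖z‖ ^ 2) ∂μ =
      (∫ u : sphere (0 : E) 1, inner ℝ (u : E) x ^ i * inner ℝ (u : E) y ^ j ∂μ.toSphere) *
        (Real.Gamma ((((Module.finrank ℝ E - 1 + (i + j) : ℕ) : ℝ) + 1) / 2) / 2) := by
    rw [integral_homogeneous_mul_exp μ _ (i + j), integral_pow_mul_exp_neg_sq]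
    intro r _ z
    simp only [inner_smul_left, RCLike.conj_to_real]
    ring
  have hparts := integral_inner_pow_by_parts μ x y hx i j
  -- The case `i = j = 0` is separate because in dimension one `k` below would be `0`, and `Γ(k /
  -- 2)` could not be cancelled.
  rcases Nat.eq_zero_or_pos (i + j) with h0 | h0
  · obtain ⟨rfl, rfl⟩ : i = 0 ∧ j = 0 := by omega
    rw [hhom] at hparts
    have hΓ := Real.Gamma_pos_of_pos
      (show 0 < (((Module.finrank ℝ E - 1 + (0 + 1 + 0) : ℕ) : ℝ) + 1) / 2 by positivity)
    simp only [Nat.cast_zero, zero_mul, add_zero, mul_eq_zero, div_eq_zero_iff, hΓ.ne',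
      OfNat.ofNat_ne_zero, or_false, false_or] at hparts
    simp only [Nat.cast_zero, zero_mul, add_zero, hparts, mul_zero]
  · set k : ℝ := (Module.finrank ℝ E : ℝ) - 1 + i + j with hk
    have hkpos : 0 < k := by
      have : (1 : ℝ) ≤ ((i + j : ℕ) : ℝ) := by exact_mod_cast h0
      push_cast at this
      rw [hk, ← hn]
      have := (Nat.cast_nonneg (Module.finrank ℝ E - 1) : (0 : ℝ) ≤ _)
      linarith
    have hΓ := Real.Gamma_pos_of_pos (show 0 < k / 2 by positivity)
    have e1 : Real.Gamma ((((Module.finrank ℝ E - 1 + (i + 1 + j) : ℕ) : ℝ) + 1) / 2)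
        = k / 2 * Real.Gamma (k / 2) := by
      rw [← Real.Gamma_add_one (by positivity)]
      congr 1
      rw [hk, Nat.cast_add, hn]
      push_cast
      ring
    -- The factor `i` is kept so that the truncated exponent `i - 1` is harmless at `i = 0`;
    -- likewise for `j` in `e3`.
    have e2 : (i : ℝ) * ∫ z, inner ℝ z x ^ (i - 1) * inner ℝ z y ^ j * Real.exp (-‖z‖ ^ 2) ∂μ =
        i * ((∫ u : sphere (0 : E) 1, inner ℝ (u : E) x ^ (i - 1) * inner ℝ (u : E) y ^ j
          ∂μ.toSphere) * (Real.Gamma (k / 2) / 2)) := by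
      rcases i with _ | i
      · simp
      · rw [hhom]
        congr 5
        rw [hk, Nat.cast_add, hn]
        push_cast
        ring
    have e3 : (j : ℝ) * inner ℝ x y *
          ∫ z, inner ℝ z x ^ i * inner ℝ z y ^ (j - 1) * Real.exp (-‖z‖ ^ 2) ∂μ =
        j * inner ℝ x y * ((∫ u : sphere (0 : E) 1,
          inner ℝ (u : E) x ^ i * inner ℝ (u : E) y ^ (j - 1) ∂μ.toSphere) *
            (Real.Gamma (k / 2) / 2)) := by
      rcases j with _ | j
      · simp
      · rw [hhom]
        congr 5
        rw [hk, Nat.cast_add, hn]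
        push_cast
        ring
    rw [e2, e3, hhom, e1] at hparts
    apply mul_right_cancel₀ (show Real.Gamma (k / 2) / 2 ≠ 0 by positivity)
    linear_combination hparts

end Polar

/-! ### Zonal polynomials as reproducing kernels on the sphere. -/

variable {d : ℕ}

instance isProbabilityMeasure_uniformSphere : IsProbabilityMeasure (uniformSphere d) := by
  have : NeZero (volume : Measure (EuclideanSpace ℝ (Fin (d + 1)))).toSphere :=
    ⟨Measure.toSphere_ne_zero _⟩
  unfold uniformSphere
  infer_instance

lemma continuous_dot (x : Sph d) : Continuous fun u : Sph d => dot u x := by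
  unfold dot
  fun_prop

lemma dot_comm (x y : Sph d) : dot x y = dot y x := real_inner_comm _ _

lemma dot_self (x : Sph d) : dot x x = 1 := by
  simp [dot]

lemma abs_dot_le_one (x y : Sph d) : |dot x y| ≤ 1 :=
  (abs_real_inner_le_norm _ _).trans (by simp)

lemma cos_geodesic (x y : Sph d) : Real.cos (geodesic x y) = dot x y :=
  Real.cos_arccos (abs_le.1 (abs_dot_le_one x y)).1 (abs_le.1 (abs_dot_le_one x y)).2

lemma exists_dot_eq (hd : 1 ≤ d) {t : ℝ} (ht : t ∈ Set.Icc (-1) 1) :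
    ∃ x y : Sph d, dot x y = t := by
  obtain ⟨d, rfl⟩ := Nat.exists_eq_add_of_le' hd
  let e : Fin (d + 1 + 1) → EuclideanSpace ℝ (Fin (d + 1 + 1)) :=
    fun i => EuclideanSpace.single i 1
  have hs : 0 ≤ 1 - t ^ 2 := by nlinarith [ht.1, ht.2]
  refine ⟨⟨e 0, by simp [e]⟩, ⟨t • e 0 + √(1 - t ^ 2) • e 1, ?_⟩, ?_⟩
  · rw [mem_sphere_zero_iff_norm, ← pow_eq_one_iff_of_nonneg (norm_nonneg _) two_ne_zero,
      norm_add_sq_real]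
    simp [e, norm_smul, inner_smul_left, inner_smul_right, EuclideanSpace.inner_single_left,
      Real.sq_sqrt hs]
  · simp [dot, e, inner_add_right, inner_smul_right, EuclideanSpace.inner_single_left]

lemma integrable_uniformSphere {f : Sph d → ℝ} (hf : Continuous f) :
    Integrable f (uniformSphere d) :=
  hf.integrable_of_hasCompactSupport (HasCompactSupport.of_compactSpace f)

/-- The bilinear form `(p, q) ↦ E[p(ω · x) q(ω · y)]` for `ω` uniform on the sphere. -/
noncomputable def zonalPairing (x y : Sph d) : ℝ[X] →ₗ[ℝ] ℝ[X] →ₗ[ℝ] ℝ :=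
  have hint (p q : ℝ[X]) : Integrable (fun u => p.eval (dot u x) * q.eval (dot u y))
      (uniformSphere d) :=
    integrable_uniformSphere
      ((p.continuous.comp (continuous_dot x)).mul (q.continuous.comp (continuous_dot y)))
  LinearMap.mk₂ ℝ (fun p q => ∫ u, p.eval (dot u x) * q.eval (dot u y) ∂uniformSphere d)
    (fun p p' q => by simp only [eval_add, add_mul]; exact integral_add (hint p q) (hint p' q))
    (fun c p q => by simp only [eval_smul, smul_eq_mul, mul_assoc, integral_const_mul])
    (fun p q q' => by simp only [eval_add, mul_add]; exact integral_add (hint p q) (hint p q'))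
    (fun c p q => by
      simp only [eval_smul, smul_eq_mul, mul_left_comm _ c, integral_const_mul])

lemma zonalPairing_apply (x y : Sph d) (p q : ℝ[X]) :
    zonalPairing x y p q = ∫ u, p.eval (dot u x) * q.eval (dot u y) ∂uniformSphere d := rfl

lemma zonalPairing_swap (x y : Sph d) (p q : ℝ[X]) :
    zonalPairing x y p q = zonalPairing y x q p := by
  simp only [zonalPairing_apply, mul_comm]

lemma zonalPairing_one (x y : Sph d) : zonalPairing x y 1 1 = 1 := by
  simp [zonalPairing_apply]

lemma zonalPairing_X_pow (x y : Sph d) (i j : ℕ) :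
    ((d : ℝ) + i + j) * zonalPairing x y (X ^ (i + 1)) (X ^ j) =
      i * zonalPairing x y (X ^ (i - 1)) (X ^ j) +
      j * dot x y * zonalPairing x y (X ^ i) (X ^ (j - 1)) := by
  have h := toSphere_moment_recurrence (volume : Measure (EuclideanSpace ℝ (Fin (d + 1))))
    (x : EuclideanSpace ℝ (Fin (d + 1))) y (by simp) i j
  simp only [finrank_euclideanSpace, Fintype.card_fin, Nat.cast_add, Nat.cast_one,
    add_sub_cancel_right] at h
  simp only [zonalPairing_apply, uniformSphere, integral_smul_measure, eval_pow, eval_X, dot,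
    smul_eq_mul]
  linear_combination
    (((volume : Measure (EuclideanSpace ℝ (Fin (d + 1)))).toSphere Set.univ)⁻¹).toReal * h

/-- This is the divergence theorem for the tangential field `p(u · x) q(u · y) ∇(u · x)`, using `∇(u
· x) · ∇(u · y) = x · y - (u · x)(u · y)`. By bilinearity it reduces to monomials, where it is the
moment recurrence. -/
lemma zonalPairing_by_parts (x y : Sph d) (p q : ℝ[X]) :
    zonalPairing x y ((1 - X ^ 2) * derivative p) q - d * zonalPairing x y (X * p) q
      + dot x y * zonalPairing x y p (derivative q)
      - zonalPairing x y (X * p) (X * derivative q) = 0 := by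
  induction p using Polynomial.induction_on' with
  | add p p' hp hp' =>
    simp only [mul_add, map_add, LinearMap.add_apply]
    linear_combination hp + hp'
  | monomial i a =>
  induction q using Polynomial.induction_on' with
  | add q q' hq hq' =>
    simp only [mul_add, map_add]
    linear_combination hq + hq'
  | monomial j b =>
    have h1 (j : ℕ) : derivative (X ^ j : ℝ[X]) = (j : ℝ) • X ^ (j - 1) := by
      rw [derivative_X_pow, smul_eq_C_mul]
    have h2 (j : ℕ) : X * derivative (X ^ j : ℝ[X]) = (j : ℝ) • X ^ j := by
      rw [h1]
      cases j <;> simp [pow_succ']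
    have h3 : (1 - X ^ 2) * derivative (X ^ i : ℝ[X]) =
        (i : ℝ) • X ^ (i - 1) - (i : ℝ) • X ^ (i + 1) := by
      have e1 := h1 i
      have e2 := h2 i
      simp only [smul_eq_C_mul] at e1 e2 ⊢
      linear_combination e1 - X * e2
    have h := zonalPairing_X_pow x y i j
    rw [← smul_X_eq_monomial, ← smul_X_eq_monomial]
    simp only [derivative_smul, mul_smul_comm, h2, h3, ← pow_succ']
    simp only [h1, map_smul, map_sub, LinearMap.smul_apply, LinearMap.sub_apply, smul_eq_mul]
    linear_combination (-a * b) * h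

/-- The right side is minus the Dirichlet form, invariant under exchanging `(x, p)` with `(y, q)`;
symmetry of the operator follows. -/
lemma zonalPairing_gegenbauerOp {l : ℝ} (hl : 2 * l + 1 = d) (x y : Sph d) (p q : ℝ[X]) :
    zonalPairing x y (gegenbauerOp l p) q =
      zonalPairing x y (X * derivative p) (X * derivative q)
        - dot x y * zonalPairing x y (derivative p) (derivative q) := by
  have h := zonalPairing_by_parts x y (derivative p) q
  have e : gegenbauerOp l p =
      (1 - X ^ 2) * derivative (derivative p) - (d : ℝ) • (X * derivative p) := by
    rw [gegenbauerOp, hl, smul_eq_C_mul, mul_assoc]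
  rw [e, map_sub, map_smul, LinearMap.sub_apply, LinearMap.smul_apply, smul_eq_mul]
  linear_combination h

lemma zonalPairing_gegenbauerOp_comm {l : ℝ} (hl : 2 * l + 1 = d) (x y : Sph d) (p q : ℝ[X]) :
    zonalPairing x y (gegenbauerOp l p) q = zonalPairing x y p (gegenbauerOp l q) := by
  rw [zonalPairing_swap x y p, zonalPairing_gegenbauerOp hl, zonalPairing_gegenbauerOp hl,
    zonalPairing_swap y x, zonalPairing_swap y x, dot_comm]

lemma zonalPairing_zonal_of_ne {l : ℝ} (hl0 : 0 ≤ l) (hl : 2 * l + 1 = d) (x y : Sph d)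
    {n m : ℕ} (hnm : n ≠ m) : zonalPairing x y (zonal l n) (zonal l m) = 0 := by
  have h := zonalPairing_gegenbauerOp_comm hl x y (zonal l n) (zonal l m)
  simp only [gegenbauerOp_zonal, ← smul_eq_C_mul, map_smul, LinearMap.smul_apply,
    smul_eq_mul] at h
  have h' : (((n : ℝ) - m) * (n + m + 2 * l)) * zonalPairing x y (zonal l n) (zonal l m) = 0 := by
    linear_combination -h
  refine (mul_eq_zero.1 h').resolve_left (mul_ne_zero ?_ ?_)
  · exact sub_ne_zero.2 (Nat.cast_injective.ne hnm)
  · have : (1 : ℝ) ≤ ((n + m : ℕ) : ℝ) := by exact_mod_cast (by omega : 1 ≤ n + m)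
    push_cast at this
    linarith

/-- Telescoping the definition of `zonal` writes `derivGegenbauer l m` as a sum of zonal polynomials
of degree below `m`, all orthogonal to degree `n`. -/
lemma zonalPairing_zonal_derivGegenbauer {l : ℝ} (hl0 : 0 ≤ l) (hl : 2 * l + 1 = d) (x y : Sph d)
    {n m : ℕ} (hnm : m ≤ n) : zonalPairing x y (zonal l n) (derivGegenbauer l m) = 0 := by
  induction m using Nat.twoStepInduction with
  | zero => simp [derivGegenbauer]
  | one => simpa [zonal, derivGegenbauer] using
      zonalPairing_zonal_of_ne hl0 hl x y (n := n) (m := 0) (by omega)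
  | more m ih _ =>
    have h : derivGegenbauer l (m + 2) = zonal l (m + 1) + derivGegenbauer l m := by
      simp [zonal]
    rw [h, map_add, ih (by omega), zonalPairing_zonal_of_ne hl0 hl x y (by omega), add_zero]

/-- The induction carries two consecutive `derivGegenbauer` because the Dirichlet form of the next
zonal polynomial involves both. -/
lemma zonalPairing_zonal_self_aux {l : ℝ} (hl0 : 0 ≤ l) (hl : 2 * l + 1 = d) (x y : Sph d)
    (n : ℕ) :
    zonalPairing x y (derivGegenbauer l n) (derivGegenbauer l n)
      = (derivGegenbauer l n).eval (dot x y) ∧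
    zonalPairing x y (derivGegenbauer l (n + 1)) (derivGegenbauer l (n + 1))
      = (derivGegenbauer l (n + 1)).eval (dot x y) ∧
    zonalPairing x y (zonal l n) (zonal l n) = (zonal l n).eval (dot x y) := by
  induction n with
  | zero => simp [derivGegenbauer, zonal, zonalPairing_one]
  | succ n ih =>
    obtain ⟨h0, h1, -⟩ := ih
    set s := dot x y
    have hn : (0 : ℝ) ≤ n := Nat.cast_nonneg n
    have hc : (n : ℝ) + 1 + l ≠ 0 := by positivity
    have hXV : X * ((2 * ((n : ℝ) + 1 + l)) • derivGegenbauer l (n + 1)) =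
        ((n : ℝ) + 1) • zonal l (n + 1) +
          (2 * ((n : ℝ) + 1 + l)) • derivGegenbauer l n := by
      refine Polynomial.funext fun t => ?_
      simp only [eval_mul, eval_X, eval_smul, eval_add, smul_eq_mul]
      linear_combination -eval_zonal_succ (l := l) n t
    have o1 := zonalPairing_zonal_derivGegenbauer hl0 hl x y (n.le_succ)
    have o2 := zonalPairing_zonal_derivGegenbauer hl0 hl y x (n.le_succ)
    rw [zonalPairing_swap] at o2
    -- The unknown pairing appears on both sides: on the left through the eigenvalue, on the right
    -- through `hXV`. Solving for it leaves only known pairings.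
    have hop := zonalPairing_gegenbauerOp hl x y (zonal l (n + 1)) (zonal l (n + 1))
    rw [gegenbauerOp_zonal, derivative_zonal, ← smul_eq_C_mul, ← smul_eq_C_mul] at hop
    push_cast at hop
    rw [hXV] at hop
    simp only [map_smul, map_add, LinearMap.smul_apply, LinearMap.add_apply, smul_eq_mul, o1, o2,
      h0, h1] at hop
    have hz : zonalPairing x y (zonal l (n + 1)) (zonal l (n + 1))
        = (zonal l (n + 1)).eval s := by
      have hn1 : (n : ℝ) + 1 ≠ 0 := by positivity
      apply mul_left_cancel₀ hn1
      apply mul_left_cancel₀ hc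
      have h := eval_zonal_succ (l := l) n s
      linear_combination (-1 / 2) * hop - ((n : ℝ) + 1 + l) * h
    refine ⟨h1, ?_, hz⟩
    have h : derivGegenbauer l (n + 2) = zonal l (n + 1) + derivGegenbauer l n := by
      simp [zonal]
    rw [h]
    simp only [map_add, LinearMap.add_apply, o1, o2, h0, hz, eval_add]
    ring

/-- The zonal polynomials are reproducing kernels on the sphere. -/
lemma integral_zonal_mul_zonal {l : ℝ} (hl0 : 0 ≤ l) (hl : 2 * l + 1 = d) (x y : Sph d) (n : ℕ) :
    ∫ u, (zonal l n).eval (dot u x) * (zonal l n).eval (dot u y) ∂uniformSphere d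
      = (zonal l n).eval (dot x y) :=
  (zonalPairing_zonal_self_aux hl0 hl x y n).2.2

/-- A reproducing kernel is largest on the diagonal: write `t = x · y` and apply `2|ab| ≤ a² + b²`
under the integral. -/
lemma abs_eval_zonal_le {l : ℝ} (hd : 1 ≤ d) (hl0 : 0 ≤ l) (hl : 2 * l + 1 = d) (n : ℕ) {t : ℝ}
    (ht : t ∈ Set.Icc (-1) 1) : |(zonal l n).eval t| ≤ (zonal l n).eval 1 := by
  obtain ⟨x, y, rfl⟩ := exists_dot_eq hd ht
  have hc (z : Sph d) : Continuous fun u => (zonal l n).eval (dot u z) :=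
    (zonal l n).continuous.comp (continuous_dot z)
  have hself (z : Sph d) := integral_zonal_mul_zonal hl0 hl z z n
  simp only [dot_self] at hself
  have hI (z : Sph d) : Integrable
      (fun u => (zonal l n).eval (dot u z) * (zonal l n).eval (dot u z)) (uniformSphere d) :=
    integrable_uniformSphere ((hc z).mul (hc z))
  rw [← integral_zonal_mul_zonal hl0 hl x y n]
  calc
    _ ≤ ∫ u, ((zonal l n).eval (dot u x) * (zonal l n).eval (dot u x)
          + (zonal l n).eval (dot u y) * (zonal l n).eval (dot u y)) / 2 ∂uniformSphere d := by
      refine (abs_integral_le_integral_abs).trans (integral_mono ?_ ?_ fun u => ?_)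
      · exact integrable_uniformSphere ((hc x).mul (hc y)).abs
      · exact ((hI x).add (hI y)).div_const 2
      · simp only
        rw [abs_le]
        constructor <;> nlinarith [sq_nonneg ((zonal l n).eval (dot u x) + (zonal l n).eval (dot u y)),
          sq_nonneg ((zonal l n).eval (dot u x) - (zonal l n).eval (dot u y))]
    _ = (zonal l n).eval 1 := by
      rw [integral_div, integral_add (hI x) (hI y), hself, hself]
      ring

/-! ### Conditioning on an independent integer variable. -/

section Independence

variable {Ω α β γ δ : Type*} [MeasurableSpace Ω] {μ : Measure Ω} [MeasurableSpace α]
  [MeasurableSpace β] [MeasurableSpace γ] [MeasurableSpace δ]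

/-- The variables are peeled off in the order in which expectations are later factored: sign,
degree, then direction against column index. -/
lemma indepFun_of_iIndep_four {X : Ω → α} {Y : Ω → β} {U : Ω → γ} {V : Ω → δ}
    (hX : Measurable X) (hY : Measurable Y) (hU : Measurable U) (hV : Measurable V)
    (h : iIndep ![MeasurableSpace.comap X inferInstance, MeasurableSpace.comap Y inferInstance,
        MeasurableSpace.comap U inferInstance, MeasurableSpace.comap V inferInstance] μ) :
    IndepFun X (fun w => (V w, Y w, U w)) μ ∧ IndepFun V (fun w => (Y w, U w)) μ ∧
      IndepFun Y U μ := by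
  have hle : ∀ i, ![MeasurableSpace.comap X inferInstance, MeasurableSpace.comap Y inferInstance,
        MeasurableSpace.comap U inferInstance, MeasurableSpace.comap V inferInstance] i
        ≤ (inferInstance : MeasurableSpace Ω) := by
    intro i
    fin_cases i
    exacts [hX.comap_le, hY.comap_le, hU.comap_le, hV.comap_le]
  set m := ![MeasurableSpace.comap X inferInstance, MeasurableSpace.comap Y inferInstance,
        MeasurableSpace.comap U inferInstance, MeasurableSpace.comap V inferInstance] with hm
  have hsup (S : Set (Fin 4)) {i : Fin 4} (hi : i ∈ S) : m i ≤ ⨆ i ∈ S, m i :=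
    le_biSup m hi
  refine ⟨?_, ?_, ?_⟩
  · have hi := indep_iSup_of_disjoint hle h (S := {0}) (T := {3, 1, 2}) (by simp)
    rw [IndepFun_iff_Indep]
    refine indep_of_indep_of_le_left (indep_of_indep_of_le_right hi ?_) (hsup {0} rfl)
    exact measurable_iff_comap_le.1 (Measurable.prodMk (measurable_iff_comap_le.2 (hsup {3, 1, 2} (i := 3) (by simp)))
      (Measurable.prodMk (measurable_iff_comap_le.2 (hsup {3, 1, 2} (i := 1) (by simp))) (measurable_iff_comap_le.2 (hsup {3, 1, 2} (i := 2) (by simp)))))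
  · have hi := indep_iSup_of_disjoint hle h (S := {3}) (T := {1, 2}) (by simp)
    rw [IndepFun_iff_Indep]
    refine indep_of_indep_of_le_left (indep_of_indep_of_le_right hi ?_) (hsup {3} rfl)
    exact measurable_iff_comap_le.1
      (Measurable.prodMk (measurable_iff_comap_le.2 (hsup {1, 2} (i := 1) (by simp))) (measurable_iff_comap_le.2 (hsup {1, 2} (i := 2) (by simp))))
  · exact h.indep (i := 1) (j := 2) (by simp)

variable {κ : Ω → ℕ} {U : Ω → α} {f : ℕ → α → ℝ}

lemma setIntegral_of_indepFun_nat [IsProbabilityMeasure μ] (hκ : Measurable κ)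
    (hU : Measurable U) (hind : IndepFun κ U μ) (hf : ∀ n, Measurable (f n)) (n : ℕ) :
    ∫ w in κ ⁻¹' {n}, f (κ w) (U w) ∂μ = μ.real (κ ⁻¹' {n}) * ∫ w, f n (U w) ∂μ := by
  have hs : MeasurableSet (κ ⁻¹' {n}) := hκ (measurableSet_singleton n)
  rw [setIntegral_congr_fun hs (g := fun w => f n (U w))
    (fun w hw => by simp only [Set.mem_preimage, Set.mem_singleton_iff] at hw; simp only [hw]),
    ← integral_indicator hs]
  have hφ : Measurable (({n} : Set ℕ).indicator (1 : ℕ → ℝ)) := .of_discrete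
  have hind' : IndepFun (fun w => ({n} : Set ℕ).indicator (1 : ℕ → ℝ) (κ w))
      (fun w => f n (U w)) μ := hind.comp hφ (hf n)
  rw [← integral_indicator_one hs]
  have := hind'.integral_fun_mul_eq_mul_integral
    (hφ.comp hκ).aestronglyMeasurable
    ((hf n).comp hU).aestronglyMeasurable
  refine Eq.trans (integral_congr_ae (.of_forall fun w => ?_)) this
  by_cases hw : κ w = n <;> simp [Set.indicator, hw]

lemma integrable_of_indepFun_nat [IsProbabilityMeasure μ] (hκ : Measurable κ)
    (hU : Measurable U) (hind : IndepFun κ U μ) (hf : ∀ n, Measurable (f n))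
    (hint : ∀ n, Integrable (fun w => f n (U w)) μ) (h0 : ∀ n v, 0 ≤ f n v)
    (hsum : Summable fun n => μ.real (κ ⁻¹' {n}) * ∫ w, f n (U w) ∂μ) :
    Integrable (fun w => f (κ w) (U w)) μ := by
  have hs (n : ℕ) : MeasurableSet (κ ⁻¹' {n}) := hκ (measurableSet_singleton n)
  have hunion : ⋃ n, κ ⁻¹' {n} = Set.univ := by
    ext w
    simp
  rw [← integrableOn_univ, ← hunion]
  refine integrableOn_iUnion_of_summable_integral_norm (fun n => ?_) ?_
  · exact (hint n).integrableOn.congr_fun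
      (fun w hw => by simp only [Set.mem_preimage, Set.mem_singleton_iff] at hw; simp only [hw])
      (hs n)
  · simpa only [Real.norm_of_nonneg (h0 _ _), setIntegral_of_indepFun_nat hκ hU hind hf]
      using hsum

lemma hasSum_integral_of_indepFun_nat [IsProbabilityMeasure μ] (hκ : Measurable κ)
    (hU : Measurable U) (hind : IndepFun κ U μ) (hf : ∀ n, Measurable (f n))
    (hint : Integrable (fun w => f (κ w) (U w)) μ) :
    HasSum (fun n => μ.real (κ ⁻¹' {n}) * ∫ w, f n (U w) ∂μ) (∫ w, f (κ w) (U w) ∂μ) := by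
  have hs (n : ℕ) : MeasurableSet (κ ⁻¹' {n}) := hκ (measurableSet_singleton n)
  have hunion : ⋃ n, κ ⁻¹' {n} = Set.univ := by
    ext w
    simp
  have hd : Pairwise (Function.onFun Disjoint fun n => κ ⁻¹' {n}) := fun n m hnm =>
    Disjoint.preimage κ (Set.disjoint_singleton.2 hnm)
  have h := hasSum_integral_iUnion (μ := μ) hs hd hint.integrableOn
  rw [hunion, setIntegral_univ] at h
  simpa only [setIntegral_of_indepFun_nat hκ hU hind hf] using h

end Independence

/-! ### Moments of randomised zonal fields. -/

section RandomField

variable {Ω : Type*} [MeasurableSpace Ω] {μ : Measure Ω} [IsProbabilityMeasure μ] {d p : ℕ}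

lemma abs_mul_transpose_apply_le (A : Matrix (Fin p) (Fin p) ℝ) (i j : Fin p) :
    |(A * A.transpose) i j| ≤ (A * A.transpose) i i + (A * A.transpose) j j := by
  simp only [Matrix.mul_apply, Matrix.transpose_apply, ← Finset.sum_add_distrib]
  refine (Finset.abs_sum_le_sum_abs _ _).trans (Finset.sum_le_sum fun k _ => ?_)
  rw [abs_le]
  constructor <;> nlinarith [sq_nonneg (A i k + A j k), sq_nonneg (A i k - A j k),
    sq_nonneg (A i k), sq_nonneg (A j k)]

lemma integral_comp_of_uniform {ι : Ω → Fin p} (hι : Measurable ι)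
    (hunif : ∀ i, μ.real (ι ⁻¹' {i}) = 1 / (p : ℝ)) (G : Fin p → ℝ) :
    ∫ w, G (ι w) ∂μ = (∑ k, G k) / p := by
  rw [← integral_map (μ := μ) (φ := ι) (f := G) hι.aemeasurable
    (Measurable.of_discrete).aestronglyMeasurable, integral_fintype .of_finite]
  simp only [map_measureReal_apply hι (measurableSet_singleton _), hunif, smul_eq_mul]
  rw [← Finset.mul_sum]
  ring

/-- The component of a randomised zonal field without the random sign. -/
noncomputable def zonalAmplitude (c a : ℕ → ℝ) (Γ : ℕ → Matrix (Fin p) (Fin p) ℝ)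
    (g : ℕ → ℝ → ℝ) (x : Sph d) (i : Fin p) (n : ℕ) (v : Sph d × Fin p) : ℝ :=
  √(c n * p / a n) * g n (dot v.1 x) * Γ n i v.2

lemma measurable_zonalAmplitude {c a : ℕ → ℝ} {Γ : ℕ → Matrix (Fin p) (Fin p) ℝ}
    {g : ℕ → ℝ → ℝ} (hg : ∀ n, Continuous (g n)) (x : Sph d) (i : Fin p) (n : ℕ) :
    Measurable (zonalAmplitude c a Γ g x i n) := by
  unfold zonalAmplitude
  have h1 : Measurable fun v : Sph d × Fin p => g n (dot v.1 x) :=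
    ((hg n).comp (continuous_dot x)).measurable.comp measurable_fst
  have h2 : Measurable fun v : Sph d × Fin p => Γ n i v.2 :=
    (Measurable.of_discrete (f := fun k => Γ n i k)).comp measurable_snd
  exact (h1.const_mul _).mul h2

variable {B Γ : ℕ → Matrix (Fin p) (Fin p) ℝ} {ω : Ω → Sph d} {ι : Ω → Fin p}
  {a c : ℕ → ℝ} {g : ℕ → ℝ → ℝ}

lemma zonalAmplitude_moments (hΓ : ∀ n, B n = Γ n * (Γ n).transpose)
    (hω : Measurable ω) (hι : Measurable ι) (hωunif : μ.map ω = uniformSphere d)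
    (hιunif : ∀ i, μ.real (ι ⁻¹' {i}) = 1 / (p : ℝ)) (hind : IndepFun ω ι μ)
    (ha : ∀ n, 0 ≤ a n) (hsupp : ∀ n, B n ≠ 0 → a n ≠ 0) (hc : ∀ n, 0 ≤ c n)
    (hg : ∀ n, Continuous (g n)) (x y : Sph d) (i j : Fin p) (n : ℕ) :
    Integrable (fun w => zonalAmplitude c a Γ g x i n (ω w, ι w) *
      zonalAmplitude c a Γ g y j n (ω w, ι w)) μ ∧
    a n * ∫ w, zonalAmplitude c a Γ g x i n (ω w, ι w) *
        zonalAmplitude c a Γ g y j n (ω w, ι w) ∂μ =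
      B n i j * (c n * ∫ u, g n (dot u x) * g n (dot u y) ∂uniformSphere d) := by
  have hp : (p : ℝ) ≠ 0 := Nat.cast_ne_zero.2 (Fin.pos i).ne'
  have hcont : Continuous fun u : Sph d => g n (dot u x) * g n (dot u y) :=
    ((hg n).comp (continuous_dot x)).mul ((hg n).comp (continuous_dot y))
  have hΓm : Measurable fun k => Γ n i k * Γ n j k := .of_discrete
  have hind' : IndepFun (fun w => g n (dot (ω w) x) * g n (dot (ω w) y))
      (fun w => Γ n i (ι w) * Γ n j (ι w)) μ := hind.comp hcont.measurable hΓm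
  have hgi : Integrable (fun w => g n (dot (ω w) x) * g n (dot (ω w) y)) μ := by
    have h := integrable_uniformSphere hcont
    rw [← hωunif] at h
    exact h.comp_measurable hω
  have hΓi : Integrable (fun w => Γ n i (ι w) * Γ n j (ι w)) μ :=
    (Integrable.of_finite (μ := μ.map ι) (f := fun k => Γ n i k * Γ n j k)).comp_measurable hι
  have hprod (w : Ω) : zonalAmplitude c a Γ g x i n (ω w, ι w) *
      zonalAmplitude c a Γ g y j n (ω w, ι w) = (c n * p / a n) *
        ((g n (dot (ω w) x) * g n (dot (ω w) y)) * (Γ n i (ι w) * Γ n j (ι w))) := by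
    have hs := Real.mul_self_sqrt (show 0 ≤ c n * p / a n from
      div_nonneg (mul_nonneg (hc n) p.cast_nonneg) (ha n))
    unfold zonalAmplitude
    linear_combination ((g n (dot (ω w) x) * g n (dot (ω w) y)) *
      (Γ n i (ι w) * Γ n j (ι w))) * hs
  simp only [hprod]
  refine ⟨(hind'.integrable_mul hgi hΓi).const_mul _, ?_⟩
  have hBij : ∑ k, Γ n i k * Γ n j k = B n i j := by
    rw [hΓ, Matrix.mul_apply]
    rfl
  have hgω : ∫ w, g n (dot (ω w) x) * g n (dot (ω w) y) ∂μ =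
      ∫ u, g n (dot u x) * g n (dot u y) ∂uniformSphere d := by
    rw [← hωunif, integral_map hω.aemeasurable hcont.aestronglyMeasurable]
  rw [integral_const_mul, hind'.integral_fun_mul_eq_mul_integral hgi.1 hΓi.1, hgω,
    integral_comp_of_uniform hι hιunif (fun k => Γ n i k * Γ n j k), hBij]
  -- When `a n = 0` the amplitude is degenerate, but then `hsupp` forces `B n = 0` and both sides
  -- vanish.
  by_cases han : a n = 0
  · have hB0 : B n = 0 := by
      by_contra h
      exact hsupp n h han
    simp [hB0]
  · field_simp

/-- First and second moments of a randomised zonal field. -/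
lemma zonalField_moments {ε : Ω → ℝ} {κ : Ω → ℕ}
    (hΓ : ∀ n, B n = Γ n * (Γ n).transpose)
    (hε : Measurable ε) (hω : Measurable ω) (hι : Measurable ι) (hκ : Measurable κ)
    (hεL2 : MemLp ε 2 μ) (hεmean : ∫ w, ε w ∂μ = 0) (hεvar : variance ε μ = 1)
    (hωunif : μ.map ω = uniformSphere d)
    (hιunif : ∀ i, μ.real (ι ⁻¹' {i}) = 1 / (p : ℝ))
    (hκlaw : ∀ n, μ.real (κ ⁻¹' {n}) = a n)
    (hsupp : ∀ n, B n ≠ 0 → a n ≠ 0)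
    (hindep : iIndep
      ![MeasurableSpace.comap ε inferInstance, MeasurableSpace.comap ω inferInstance,
        MeasurableSpace.comap ι inferInstance, MeasurableSpace.comap κ inferInstance] μ)
    (hc : ∀ n, 0 ≤ c n) (hg : ∀ n, Continuous (g n))
    (hsum : ∀ x : Sph d, ∀ i, Summable fun n =>
      B n i i * (c n * ∫ u, g n (dot u x) * g n (dot u x) ∂uniformSphere d)) :
    (∀ x i, MemLp (fun w => ε w * zonalAmplitude c a Γ g x i (κ w) (ω w, ι w)) 2 μ) ∧
    (∀ x i, ∫ w, ε w * zonalAmplitude c a Γ g x i (κ w) (ω w, ι w) ∂μ = 0) ∧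
    ∀ x y i j, HasSum
      (fun n => B n i j * (c n * ∫ u, g n (dot u x) * g n (dot u y) ∂uniformSphere d))
      (covariance (fun w => ε w * zonalAmplitude c a Γ g x i (κ w) (ω w, ι w))
        (fun w => ε w * zonalAmplitude c a Γ g y j (κ w) (ω w, ι w)) μ) := by
  obtain ⟨hind1, hind2, hind3⟩ := indepFun_of_iIndep_four hε hω hι hκ hindep
  have ha (n : ℕ) : 0 ≤ a n := hκlaw n ▸ measureReal_nonneg
  have hmom := zonalAmplitude_moments (c := c) hΓ hω hι hωunif hιunif hind3 ha hsupp hc hg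
  have hAm (x : Sph d) (i : Fin p) (n : ℕ) := measurable_zonalAmplitude (c := c) (a := a) (Γ := Γ)
    hg x i n
  have hA2m (x : Sph d) (i : Fin p) :
      Measurable fun v : ℕ × Sph d × Fin p => zonalAmplitude c a Γ g x i v.1 v.2 :=
    measurable_from_prod_countable_right (hAm x i)
  have hU : Measurable fun w => (ω w, ι w) := hω.prodMk hι
  have hκU : Measurable fun w => (κ w, ω w, ι w) := hκ.prodMk hU
  set A : Sph d → Fin p → Ω → ℝ := fun x i w => zonalAmplitude c a Γ g x i (κ w) (ω w, ι w)
    with hA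
  have hAmeas (x : Sph d) (i : Fin p) : Measurable (A x i) := (hA2m x i).comp hκU
  -- Squares are nonnegative, so the diagonal series alone decides integrability; mixed products are
  -- then integrable as products of `L²` functions.
  have hAL2 (x : Sph d) (i : Fin p) : MemLp (A x i) 2 μ := by
    rw [memLp_two_iff_integrable_sq (hAmeas x i).aestronglyMeasurable]
    simp only [pow_two]
    refine integrable_of_indepFun_nat (f := fun n v => zonalAmplitude c a Γ g x i n v *
      zonalAmplitude c a Γ g x i n v) hκ hU hind2 (fun n => (hAm x i n).mul (hAm x i n))
      (fun n => (hmom x x i i n).1) (fun n v => mul_self_nonneg _) ?_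
    simpa only [hκlaw, (hmom _ _ _ _ _).2] using hsum x i
  have hAA (x y : Sph d) (i j : Fin p) : HasSum
      (fun n => B n i j * (c n * ∫ u, g n (dot u x) * g n (dot u y) ∂uniformSphere d))
      (∫ w, A x i w * A y j w ∂μ) := by
    have h := hasSum_integral_of_indepFun_nat (f := fun n v => zonalAmplitude c a Γ g x i n v *
      zonalAmplitude c a Γ g y j n v) hκ hU hind2 (fun n => (hAm x i n).mul (hAm y j n))
      ((hAL2 x i).integrable_mul (hAL2 y j))
    simpa only [hκlaw, (hmom _ _ _ _ _).2] using h
  have hindA (x : Sph d) (i : Fin p) : IndepFun ε (A x i) μ :=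
    hind1.comp measurable_id (hA2m x i)
  have hindAA (x y : Sph d) (i j : Fin p) :
      IndepFun (fun w => ε w ^ 2) (fun w => A x i w * A y j w) μ :=
    hind1.comp (measurable_id.pow_const 2) ((hA2m x i).mul (hA2m y j))
  have hε2 : Integrable (fun w => ε w ^ 2) μ := hεL2.integrable_sq
  have hε21 : ∫ w, ε w ^ 2 ∂μ = 1 := by
    rw [← hεvar, variance_of_integral_eq_zero hε.aemeasurable hεmean]
  have hmem (x : Sph d) (i : Fin p) : MemLp (fun w => ε w * A x i w) 2 μ := by
    refine (memLp_two_iff_integrable_sq (hε.mul (hAmeas x i)).aestronglyMeasurable).2 ?_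
    have h := (hindAA x x i i).integrable_mul hε2 ((hAL2 x i).integrable_mul (hAL2 x i))
    refine h.congr (.of_forall fun w => ?_)
    simp only [Pi.mul_apply]
    ring
  have hmean (x : Sph d) (i : Fin p) : ∫ w, ε w * A x i w ∂μ = 0 := by
    rw [(hindA x i).integral_fun_mul_eq_mul_integral hε.aestronglyMeasurable
      (hAmeas x i).aestronglyMeasurable, hεmean, zero_mul]
  refine ⟨hmem, hmean, fun x y i j => ?_⟩
  have hcov : covariance (fun w => ε w * A x i w) (fun w => ε w * A y j w) μ =
      ∫ w, A x i w * A y j w ∂μ := by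
    rw [covariance_eq_sub (hmem x i) (hmem y j), hmean, zero_mul, sub_zero]
    have h := (hindAA x y i j).integral_fun_mul_eq_mul_integral hε2.1
      ((hAmeas x i).mul (hAmeas y j)).aestronglyMeasurable
    rw [hε21, one_mul] at h
    rw [← h]
    refine integral_congr_ae (.of_forall fun w => ?_)
    simp only [Pi.mul_apply]
    ring
  rw [hcov]
  exact hAA x y i j

end RandomField

/-! ### The Schoenberg basis through zonal polynomials. -/

/-- The ratio between the Schoenberg basis functions and the zonal polynomials. -/
noncomputable def zonalWeight (d n : ℕ) : ℝ :=
  if d = 1 then if n = 0 then 1 else 1 / 2 else (((d : ℝ) - 1) / 2) / (n + ((d : ℝ) - 1) / 2)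

lemma half_pred_nonneg {d : ℕ} (hd : 1 ≤ d) : 0 ≤ ((d : ℝ) - 1) / 2 := by
  have : (1 : ℝ) ≤ d := by exact_mod_cast hd
  linarith

lemma zonalWeight_nonneg {d : ℕ} (hd : 1 ≤ d) (n : ℕ) : 0 ≤ zonalWeight d n := by
  have := half_pred_nonneg hd
  unfold zonalWeight
  split_ifs <;> positivity

lemma schoenbergBasis_eq_zonal {d : ℕ} (hd : 1 ≤ d) (n : ℕ) (θ : ℝ) :
    schoenbergBasis d n θ =
      zonalWeight d n * (zonal (((d : ℝ) - 1) / 2) n).eval (Real.cos θ) := by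
  unfold schoenbergBasis zonalWeight
  split_ifs with h1 h2
  · simp [h2, zonal]
  · subst h1
    obtain ⟨n, rfl⟩ := Nat.exists_eq_succ_of_ne_zero h2
    have := eval_zonal_zero_cos n θ
    simp only [Nat.cast_one, sub_self, zero_div, Nat.succ_eq_add_one, this]
    ring
  · have hd2 : (2 : ℝ) ≤ d := by exact_mod_cast (by omega : 2 ≤ d)
    have hl : 0 < ((d : ℝ) - 1) / 2 := by linarith
    have h := mul_gegenbauer_eq_zonal (l := ((d : ℝ) - 1) / 2) n (Real.cos θ)
    rw [div_mul_eq_mul_div, eq_div_iff (by positivity), mul_comm, h]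

lemma abs_schoenbergBasis_le {d : ℕ} (hd : 1 ≤ d) (n : ℕ) (θ : ℝ) :
    |schoenbergBasis d n θ| ≤ schoenbergBasis d n 0 := by
  rw [schoenbergBasis_eq_zonal hd, schoenbergBasis_eq_zonal hd, abs_mul,
    abs_of_nonneg (zonalWeight_nonneg hd n), Real.cos_zero]
  exact mul_le_mul_of_nonneg_left (abs_eval_zonal_le hd (half_pred_nonneg hd) (by ring) n
    ⟨Real.neg_one_le_cos θ, Real.cos_le_one θ⟩) (zonalWeight_nonneg hd n)

lemma continuous_schoenbergBasis {d : ℕ} (hd : 1 ≤ d) (n : ℕ) :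
    Continuous (schoenbergBasis d n) := by
  simp_rw [funext (schoenbergBasis_eq_zonal hd n)]
  fun_prop

/-! ### Convergence of the expansion and isotropy for general degree weights. -/

section Expansion

variable {d p : ℕ} {B Γ : ℕ → Matrix (Fin p) (Fin p) ℝ}

lemma summable_schoenberg_bound (hB : IsSchoenbergSequence d B) (i j : Fin p) :
    Summable fun n => (B n i i + B n j j) * schoenbergBasis d n 0 := by
  simpa only [add_mul] using (hB.summable i i).add (hB.summable j j)

lemma abs_mul_schoenbergBasis_le (hd : 1 ≤ d) (hΓ : ∀ n, B n = Γ n * (Γ n).transpose)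
    (n : ℕ) (i j : Fin p) (θ : ℝ) :
    |B n i j * schoenbergBasis d n θ| ≤ (B n i i + B n j j) * schoenbergBasis d n 0 := by
  have h : |B n i j| ≤ B n i i + B n j j := by
    rw [hΓ]
    exact abs_mul_transpose_apply_le _ i j
  rw [abs_mul]
  exact mul_le_mul h (abs_schoenbergBasis_le hd n θ) (abs_nonneg _) ((abs_nonneg _).trans h)

lemma summable_mul_schoenbergBasis (hd : 1 ≤ d) (hB : IsSchoenbergSequence d B)
    (hΓ : ∀ n, B n = Γ n * (Γ n).transpose) (i j : Fin p) (θ : ℝ) :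
    Summable fun n => B n i j * schoenbergBasis d n θ :=
  .of_norm_bounded (summable_schoenberg_bound hB i j)
    fun n => abs_mul_schoenbergBasis_le hd hΓ n i j θ

lemma continuous_schoenbergSeries (hd : 1 ≤ d) (hB : IsSchoenbergSequence d B)
    (hΓ : ∀ n, B n = Γ n * (Γ n).transpose) : Continuous (schoenbergSeries d B) := by
  refine continuous_matrix fun i j => ?_
  exact continuous_tsum (fun n => continuous_const.mul (continuous_schoenbergBasis hd n))
    (summable_schoenberg_bound hB i j) fun n θ => abs_mul_schoenbergBasis_le hd hΓ n i j θ

variable {Ω : Type*} [MeasurableSpace Ω] {μ : Measure Ω} [IsProbabilityMeasure μ]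
  {ε : Ω → ℝ} {ω : Ω → Sph d} {ι : Ω → Fin p} {κ : Ω → ℕ} {a c : ℕ → ℝ}

/-- A randomised zonal field with degree weights `c` is isotropic, and its isotropic part has
the Schoenberg matrices `c n * zonalWeight d n • B n`. -/
lemma isIsotropicWith_of_weights (hd : 1 ≤ d) (hΓ : ∀ n, B n = Γ n * (Γ n).transpose)
    (hε : Measurable ε) (hω : Measurable ω) (hι : Measurable ι) (hκ : Measurable κ)
    (hεL2 : MemLp ε 2 μ) (hεmean : ∫ w, ε w ∂μ = 0) (hεvar : variance ε μ = 1)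
    (hωunif : μ.map ω = uniformSphere d)
    (hιunif : ∀ i, μ.real (ι ⁻¹' {i}) = 1 / (p : ℝ))
    (hκlaw : ∀ n, μ.real (κ ⁻¹' {n}) = a n)
    (hsupp : ∀ n, B n ≠ 0 → a n ≠ 0)
    (hindep : iIndep
      ![MeasurableSpace.comap ε inferInstance, MeasurableSpace.comap ω inferInstance,
        MeasurableSpace.comap ι inferInstance, MeasurableSpace.comap κ inferInstance] μ)
    (hc : ∀ n, 0 ≤ c n) {K : ℝ → Matrix (Fin p) (Fin p) ℝ}
    (hKcont : Continuous K)
    (hK : ∀ θ i j, HasSum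
      (fun n => c n * zonalWeight d n * (B n i j * schoenbergBasis d n θ)) (K θ i j))
    {Z : Sph d → Ω → Fin p → ℝ}
    (hZ : ∀ x w i, Z x w i = ε w * √(c (κ w) * p / a (κ w)) *
      schoenbergBasis d (κ w) (geodesic (ω w) x) * Γ (κ w) i (ι w)) :
    IsIsotropicWith μ Z K ∧ ∀ x i, ∫ w, Z x w i ∂μ = 0 := by
  set g : ℕ → ℝ → ℝ := fun n t => zonalWeight d n * (zonal (((d : ℝ) - 1) / 2) n).eval t with hg
  have hgcont (n : ℕ) : Continuous (g n) := by
    simp only [hg]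
    fun_prop
  have hZ' (x : Sph d) (i : Fin p) : (fun w => Z x w i) =
      fun w => ε w * zonalAmplitude c a Γ g x i (κ w) (ω w, ι w) := by
    funext w
    rw [hZ, schoenbergBasis_eq_zonal hd, cos_geodesic, zonalAmplitude]
    ring
  -- Reproduction gives the squared weight times the zonal polynomial. One weight is absorbed into
  -- the basis function, the other stays as the factor that `c n` must compensate.
  have hterm (x y : Sph d) (i j : Fin p) (n : ℕ) :
      B n i j * (c n * ∫ u, g n (dot u x) * g n (dot u y) ∂uniformSphere d) =
        c n * zonalWeight d n * (B n i j * schoenbergBasis d n (geodesic x y)) := by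
    have hI : ∫ u, g n (dot u x) * g n (dot u y) ∂uniformSphere d = zonalWeight d n ^ 2 *
        (zonal (((d : ℝ) - 1) / 2) n).eval (dot x y) := by
      rw [← integral_zonal_mul_zonal (half_pred_nonneg hd) (by ring) x y n, ← integral_const_mul]
      refine integral_congr_ae (.of_forall fun u => ?_)
      simp only [hg]
      ring
    rw [hI, schoenbergBasis_eq_zonal hd, cos_geodesic]
    ring
  obtain ⟨hmem, hmean, hcov⟩ := zonalField_moments (c := c) (g := g) hΓ hε hω hι hκ hεL2 hεmean
    hεvar hωunif hιunif hκlaw hsupp hindep hc hgcont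
    (fun x i => by simpa only [hterm] using (hK (geodesic x x) i i).summable)
  simp only [hterm] at hcov
  have hmean' (x : Sph d) (i : Fin p) : ∫ w, Z x w i ∂μ = 0 := by
    rw [hZ', hmean]
  refine ⟨⟨fun x i => ?_, ⟨0, hmean'⟩, hKcont.continuousOn, fun x y i j => ?_⟩, hmean'⟩
  · rw [hZ']
    exact hmem x i
  · rw [hZ', hZ']
    exact (hcov x y i j).unique (hK _ i j)

end Expansion

end TurningArcs

theorem proposition2 {Ω : Type*} [MeasurableSpace Ω] (μ : Measure Ω) [IsProbabilityMeasure μ]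
    (d p : ℕ)
    (B Γ : ℕ → Matrix (Fin p) (Fin p) ℝ)
    (hB : IsSchoenbergSequence d B)
    (hΓ : ∀ n, B n = Γ n * (Γ n).transpose)
    (ε : Ω → ℝ) (ω : Ω → Sph d) (ι : Ω → Fin p) (κ : Ω → ℕ)
    (hε : Measurable ε) (hω : Measurable ω) (hι : Measurable ι) (hκ : Measurable κ)
    (hεL2 : MemLp ε 2 μ) (hεmean : ∫ w, ε w ∂μ = 0) (hεvar : variance ε μ = 1)
    (hωunif : μ.map ω = uniformSphere d)
    (hιunif : ∀ i, μ.real (ι ⁻¹' {i}) = 1 / (p : ℝ))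
    (a : ℕ → ℝ) (hκlaw : ∀ n, μ.real (κ ⁻¹' {n}) = a n)
    (hsupp : ∀ n, B n ≠ 0 → a n ≠ 0)
    (hindep : iIndep
      ![MeasurableSpace.comap ε inferInstance, MeasurableSpace.comap ω inferInstance,
        MeasurableSpace.comap ι inferInstance, MeasurableSpace.comap κ inferInstance] μ) :
    -- the Schoenberg expansion converges entrywise on `[0, π]`
    (1 ≤ d → ∀ θ ∈ Set.Icc 0 Real.pi, ∀ i j,
      HasSum (fun n => B n i j * schoenbergBasis d n θ) (schoenbergSeries d B θ i j)) ∧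
    -- the circle, weight `2` at every degree: the constant term is counted twice
    (d = 1 →
      IsIsotropicWith μ (cosineField (d := d) (fun _ => 2) a Γ ε ω ι κ)
        (fun θ => B 0 + schoenbergSeries d B θ) ∧
      ∀ x i, ∫ w, cosineField (d := d) (fun _ => 2) a Γ ε ω ι κ x w i ∂μ = 0) ∧
    -- the circle, weight `1` at degree `0` and weight `2` at the other degrees
    (d = 1 →
      IsIsotropicWith μ (cosineField (d := d) (fun n => if n = 0 then 1 else 2) a Γ ε ω ι κ)
        (schoenbergSeries d B) ∧
      ∀ x i, ∫ w, cosineField (d := d) (fun n => if n = 0 then 1 else 2) a Γ ε ω ι κ x w i ∂μ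
        = 0) ∧
    -- spheres of dimension at least two
    (2 ≤ d →
      IsIsotropicWith μ (gegenbauerField (d := d) a Γ ε ω ι κ) (schoenbergSeries d B) ∧
      ∀ x i, ∫ w, gegenbauerField (d := d) a Γ ε ω ι κ x w i ∂μ = 0) := by

  have hsum (hd : 1 ≤ d) (θ : ℝ) (i j : Fin p) :
      HasSum (fun n => B n i j * schoenbergBasis d n θ) (schoenbergSeries d B θ i j) :=
    (summable_mul_schoenbergBasis hd hB hΓ i j θ).hasSum
  refine ⟨fun hd θ _ i j => hsum hd θ i j, fun hd => ?_, fun hd => ?_, fun hd => ?_⟩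
  · have hd1 : 1 ≤ d := hd.ge
    refine isIsotropicWith_of_weights (c := fun _ => 2)
      (K := fun θ => B 0 + schoenbergSeries d B θ) hd1 hΓ hε hω hι hκ hεL2 hεmean hεvar
      hωunif hιunif hκlaw hsupp hindep (fun _ => zero_le_two)
      (continuous_const.add (continuous_schoenbergSeries hd1 hB hΓ)) (fun θ i j => ?_)
      fun x w i => ?_
    -- `2 * zonalWeight 1 n` is `2` at degree `0` and `1` elsewhere; the surplus is a series
    -- supported at `n = 0`.
    · have h := (hasSum_ite_eq 0 (B 0 i j)).add (hsum hd1 θ i j)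
      refine h.congr_fun fun n => ?_
      by_cases hn : n = 0
      · simp [hn, hd, zonalWeight, schoenbergBasis]
        ring
      · simp [hn, hd, zonalWeight]
    · simp [cosineField, schoenbergBasis, hd, Matrix.col]
  · have hd1 : 1 ≤ d := hd.ge
    refine isIsotropicWith_of_weights (c := fun n => if n = 0 then 1 else 2) hd1 hΓ hε hω hι hκ
      hεL2 hεmean hεvar hωunif hιunif hκlaw hsupp hindep
      (fun n => by split_ifs <;> norm_num)
      (continuous_schoenbergSeries hd1 hB hΓ) (fun θ i j => ?_) fun x w i => ?_
    · refine (hsum hd1 θ i j).congr_fun fun n => ?_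
      by_cases hn : n = 0 <;> simp [hn, hd, zonalWeight]
    · simp [cosineField, schoenbergBasis, hd, Matrix.col]
  · have hd1 : 1 ≤ d := by omega
    have hdne : d ≠ 1 := by omega
    have hd2 : (2 : ℝ) ≤ d := by exact_mod_cast hd
    have hl : 0 < (d : ℝ) - 1 := by linarith
    refine isIsotropicWith_of_weights (c := fun n => (2 * (n : ℝ) + d - 1) / ((d : ℝ) - 1)) hd1
      hΓ hε hω hι hκ hεL2 hεmean hεvar hωunif hιunif hκlaw hsupp hindep
      (fun n => div_nonneg (by linarith [(Nat.cast_nonneg n : (0 : ℝ) ≤ n)]) hl.le)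
      (continuous_schoenbergSeries hd1 hB hΓ) (fun θ i j => ?_) fun x w i => ?_
    · refine (hsum hd1 θ i j).congr_fun fun n => ?_
      have hn : (0 : ℝ) < 2 * n + d - 1 := by linarith [(Nat.cast_nonneg n : (0 : ℝ) ≤ n)]
      have hn' : (n : ℝ) + ((d : ℝ) - 1) / 2 ≠ 0 := by linarith
      -- The prescribed factor is `(n + l) / l` with `l = (d - 1) / 2`, exactly the inverse weight.
      have hw : (2 * (n : ℝ) + d - 1) / ((d : ℝ) - 1) * zonalWeight d n = 1 := by
        rw [zonalWeight, if_neg hdne]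
        field_simp
        ring
      rw [hw, one_mul]
    · have hs : (2 * (κ w : ℝ) + d - 1) / ((d : ℝ) - 1) * p / a (κ w) =
          p * (2 * (κ w : ℝ) + d - 1) / (a (κ w) * ((d : ℝ) - 1)) := by
        rw [div_mul_eq_mul_div, div_div, mul_comm (p : ℝ), mul_comm (a (κ w))]
      simp only [gegenbauerField, schoenbergBasis, if_neg hdne, cos_geodesic, hs, Pi.smul_apply,
        smul_eq_mul]
      rfl
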